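/- Throughout, a graph $\Gamma$ is either a finite connected graph without loop edges (multiple edges allowed; its points are its vertices) or a compact connected metric graph (all points of edges are points). Let $g$ be its genus (first Betti number), $K_\Gamma=\sum_p(\mathrm{val}(p)-2)\,p$ its canonical divisor, $\sim$ linear equivalence of divisors (chip-firing, respectively divisors of continuous piecewise linear functions with integer slopes) and $r$ the Baker–Norine rank. Let $v,w$ be points of $\Gamma$. A divisor $D$ is submodular (with respect to $v,w$) if every twist $D'=D+av-bw$ ($a,b\in\mathbb Z$) satisfies $r(D')-r(D'-v)-r(D'-w)+r(D'-v-w)\ge 0$. The transmission permutation of $D$, if it exists, is the unique permutation $\tau$ of $\mathbb Z$ such that for all $a,b\in\mathbb Z$ the following two (equivalent) equations hold: $$r(D+av-bw)+1=\#\{n\ge b:\tau(n)\le a\},\qquad r(K_\Gamma-D-av+bw)+1=\#\{n<b:\tau(n)>a\}.$$ It exists if and only if $D$ is submodular. For $k\ge 2$, $(\Gamma,v,w)$ has $k$-general transmission if every divisor $D$ on $\Gamma$ is submodular and its transmission permutation $\tau$ satisfies $\tau(n+k)=\tau(n)+k$ for all $n\in\mathbb Z$ and has at most $g$ inversions up to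 translation by $k$, that is, there are at most $g$ pairs $(i,j)\in\mathbb Z^2$ with $i<j$, $\tau(i)>\tau(j)$ and $0\le j<k$. **Theorem C.** Let $k\ge 2$ and suppose that $(\Gamma,v,w)$ has $k$-general transmission. Then $kv\sim kw$ and $r(kv)\ge 1$. Moreover, put $F=kv$; for every divisor $D$ on $\Gamma$ there is a nondecreasing $k$-tuple of integers $\mu=(\mu_1,\dots,\mu_k)$ such that $$\deg D=g-1+\sum_{i=1}^k(\mu_i+1)\quad\text{and}\quad r(D+mF)=\sum_{i=1}^k\max\{0,\mu_i+m+1\}-1\ \text{ for all } m\in\mathbb Z$$ (that is, the class of $D$ lies in the splitting type locus $W^\mu(\Gamma)$ with respect to $F$), and whose expected codimension satisfies $$|\mu|=\sum_{i<j}\max\{0,\mu_j-\mu_i-1\}\le g.$$ -/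

import Mathlib

open scoped Topology

universe u

namespace BrillNoether

/-! ### Graphs -/

/-- A finite connected multigraph. Every edge carries a reference orientation from `src` to `tgt`;
none of the notions below depends on the choice of orientation. -/
structure Multigraph where
  V : Type u
  E : Type u
  [fintypeV : Fintype V]
  [fintypeE : Fintype E]
  [decV : DecidableEq V]
  src : E → V
  tgt : E → V
  nonempty : Nonempty V
  connected : ∀ x y : V, Relation.EqvGen (fun a b => ∃ e, src e = a ∧ tgt e = b) x y

attribute [instance] Multigraph.fintypeV Multigraph.fintypeE Multigraph.decV

namespace Multigraph

/-- The valence of a vertex: the number of half-edges at it (a loop counts twice). -/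
def valence (G : Multigraph.{u}) (x : G.V) : ℕ :=
  (Finset.univ.filter fun e : G.E => G.src e = x).card +
    (Finset.univ.filter fun e : G.E => G.tgt e = x).card

/-- The genus (first Betti number) `|E| - |V| + 1`. -/
def genus (G : Multigraph.{u}) : ℤ :=
  (Fintype.card G.E : ℤ) - (Fintype.card G.V : ℤ) + 1

end Multigraph

/-- A finite connected graph without loop edges (multiple edges are allowed). -/
structure FiniteGraph extends Multigraph.{u} where
  loopless : ∀ e : E, src e ≠ tgt e

/-- A compact connected metric graph, given by a model: a finite connected multigraph with a
positive length on every edge. The edge `e` is a copy of the interval `[0, length e]`. -/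
structure MetricGraph extends Multigraph.{u} where
  length : E → ℝ
  length_pos : ∀ e, 0 < length e

namespace FiniteGraph

/-- The divisor `D` is the divisor of the integer-valued function `f` on the vertices, that is, it
is obtained from `0` by chip-firing moves. -/
def IsDivOf (G : FiniteGraph.{u}) (f : G.V → ℤ) (D : G.V →₀ ℤ) : Prop :=
  ∀ x : G.V, D x =
    (∑ e ∈ Finset.univ.filter fun e : G.E => G.src e = x, (f (G.tgt e) - f x)) +
      ∑ e ∈ Finset.univ.filter fun e : G.E => G.tgt e = x, (f (G.src e) - f x)

/-- Principal divisors of a finite graph. -/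
def IsPrincipal (G : FiniteGraph.{u}) (D : G.V →₀ ℤ) : Prop :=
  ∃ f : G.V → ℤ, G.IsDivOf f D

/-- The canonical divisor `∑ (valence x - 2) x`. -/
noncomputable def canonical (G : FiniteGraph.{u}) : G.V →₀ ℤ :=
  ∑ x : G.V, Finsupp.single x ((G.valence x : ℤ) - 2)

end FiniteGraph

namespace MetricGraph

/-- The points of a metric graph: the vertices of the model and the interior points of edges. -/
abbrev Point (Γ : MetricGraph.{u}) : Type u :=
  Γ.V ⊕ ((e : Γ.E) × Set.Ioo (0 : ℝ) (Γ.length e))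

/-- The point of the edge `e` at distance `t ∈ [0, length e]` from its source. -/
noncomputable def pt (Γ : MetricGraph.{u}) (e : Γ.E) (t : ℝ) : Γ.Point :=
  if h₀ : t ≤ 0 then Sum.inl (Γ.src e)
  else if h₁ : Γ.length e ≤ t then Sum.inl (Γ.tgt e)
  else Sum.inr ⟨e, t, not_le.mp h₀, not_le.mp h₁⟩

/-- `f` is a rational function on the metric graph and `D` is its divisor. Along each tangent
direction at each point, `f` is affine with integer slope near the point (`fwd e t` and `bwd e t`
are the slopes at the point of `e` with coordinate `t` in the directions of increasing and
decreasing coordinate); since edges are compact, this says exactly that `f` is continuous and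
piecewise linear on each edge with finitely many pieces and integer slopes. The coefficient
of `D` at a point is the sum of the outgoing slopes of `f` there. -/
def IsDivOf (Γ : MetricGraph.{u}) (f : Γ.Point → ℝ) (D : Γ.Point →₀ ℤ) : Prop :=
  ∃ fwd bwd : Γ.E → ℝ → ℤ,
    (∀ e, ∀ t ∈ Set.Ico (0 : ℝ) (Γ.length e), ∀ᶠ u in 𝓝[>] (0 : ℝ),
      f (Γ.pt e (t + u)) = f (Γ.pt e t) + (fwd e t : ℝ) * u) ∧
    (∀ e, ∀ t ∈ Set.Ioc (0 : ℝ) (Γ.length e), ∀ᶠ u in 𝓝[>] (0 : ℝ),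
      f (Γ.pt e (t - u)) = f (Γ.pt e t) + (bwd e t : ℝ) * u) ∧
    (∀ x : Γ.V, D (Sum.inl x) =
      (∑ e ∈ Finset.univ.filter fun e : Γ.E => Γ.src e = x, fwd e 0) +
        ∑ e ∈ Finset.univ.filter fun e : Γ.E => Γ.tgt e = x, bwd e (Γ.length e)) ∧
    (∀ (e : Γ.E) (t : Set.Ioo (0 : ℝ) (Γ.length e)),
      D (Sum.inr ⟨e, t⟩) = fwd e t + bwd e t)

/-- Principal divisors of a metric graph. -/
def IsPrincipal (Γ : MetricGraph.{u}) (D : Γ.Point →₀ ℤ) : Prop :=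
  ∃ f : Γ.Point → ℝ, Γ.IsDivOf f D

/-- The canonical divisor `∑ (valence p - 2) p`; interior points of edges have valence `2`. -/
noncomputable def canonical (Γ : MetricGraph.{u}) : Γ.Point →₀ ℤ :=
  ∑ x : Γ.V, Finsupp.single (Sum.inl x) ((Γ.valence x : ℤ) - 2)

end MetricGraph

/-- A graph is either a finite connected graph without loop edges or a connected metric graph. -/
inductive Graph : Type (u + 1)
  | finite (G : FiniteGraph.{u}) : Graph
  | metric (Γ : MetricGraph.{u}) : Graph

namespace Graph

/-- The points of a graph: the vertices of a finite graph, all points of a metric graph. -/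
abbrev Point : Graph.{u} → Type u
  | finite G => G.V
  | metric Γ => Γ.Point

/-- Divisors: finite `ℤ`-linear combinations of points. -/
abbrev Divisor (Γ : Graph.{u}) : Type u := Γ.Point →₀ ℤ

/-- The genus of a graph. -/
def genus : Graph.{u} → ℤ
  | finite G => G.genus
  | metric Γ => Γ.genus

/-- Principal divisors. -/
def IsPrincipal : (Γ : Graph.{u}) → Γ.Divisor → Prop
  | finite G => G.IsPrincipal
  | metric Γ => Γ.IsPrincipal

/-- The canonical divisor. -/
noncomputable def canonical : (Γ : Graph.{u}) → Γ.Divisor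
  | finite G => G.canonical
  | metric Γ => Γ.canonical

variable (Γ : Graph.{u})

/-- The divisor consisting of one chip at the point `p`. -/
noncomputable def chip (p : Γ.Point) : Γ.Divisor := Finsupp.single p 1

/-- The degree of a divisor. -/
noncomputable def deg (D : Γ.Divisor) : ℤ := D.sum fun _ n => n

/-- Linear equivalence `D ∼ E`. -/
def LinEquiv (D E : Γ.Divisor) : Prop := Γ.IsPrincipal (D - E)

/-- `D` is linearly equivalent to an effective divisor. -/
def EquivEffective (D : Γ.Divisor) : Prop := ∃ E : Γ.Divisor, 0 ≤ E ∧ Γ.LinEquiv D E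

/-- The Baker--Norine rank: the largest integer `n ≥ -1` such that `D - E` is equivalent to an
effective divisor for every effective `E` of degree `n` (for `n = -1` there is no such `E`, and
the set is bounded above by `max (-1) (deg D)`). -/
noncomputable def rank (D : Γ.Divisor) : ℤ :=
  sSup {n : ℤ | -1 ≤ n ∧
    ∀ E : Γ.Divisor, 0 ≤ E → Γ.deg E = n → Γ.EquivEffective (D - E)}

/-- The twist `D + a v - b w`. -/
noncomputable def twist (v w : Γ.Point) (D : Γ.Divisor) (a b : ℤ) : Γ.Divisor :=
  D + a • Γ.chip v - b • Γ.chip w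

/-- `Δ(D) = r(D) - r(D - v) - r(D - w) + r(D - v - w)`. -/
noncomputable def Delta (v w : Γ.Point) (D : Γ.Divisor) : ℤ :=
  Γ.rank D - Γ.rank (D - Γ.chip v) - Γ.rank (D - Γ.chip w) +
    Γ.rank (D - Γ.chip v - Γ.chip w)

/-- `D` is submodular with respect to `v, w`. -/
def IsSubmodular (v w : Γ.Point) (D : Γ.Divisor) : Prop :=
  ∀ a b : ℤ, 0 ≤ Γ.Delta v w (Γ.twist v w D a b)

/-- `τ` is the transmission permutation of `D` on `(Γ, v, w)`. -/
def IsTransmissionPerm (v w : Γ.Point) (D : Γ.Divisor) (τ : Equiv.Perm ℤ) : Prop :=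
  ∀ a b : ℤ,
    ({n : ℤ | b ≤ n ∧ τ n ≤ a}.Finite ∧
      Γ.rank (Γ.twist v w D a b) + 1 = ({n : ℤ | b ≤ n ∧ τ n ≤ a}.ncard : ℤ)) ∧
    ({n : ℤ | n < b ∧ a < τ n}.Finite ∧
      Γ.rank (Γ.canonical - Γ.twist v w D a b) + 1 =
        ({n : ℤ | n < b ∧ a < τ n}.ncard : ℤ))

end Graph

/-! ### Permutations of the integers -/

/-- The inversions of a permutation of `ℤ`. -/
def inversions (α : Equiv.Perm ℤ) : Set (ℤ × ℤ) :=
  {p | p.1 < p.2 ∧ α p.2 < α p.1}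

/-- The group of permutations with finitely many inversions if `k = 0`, and the extended affine
symmetric group if `k ≥ 2` (as a set of permutations). -/
def extAffine (k : ℕ) : Set (Equiv.Perm ℤ) :=
  {α | if k = 0 then (inversions α).Finite else ∀ n : ℤ, α (n + k) = α n + k}

/-- For `α ∈ extAffine k`, the number of inversions of `α` up to simultaneous translation by
multiples of `k`: all inversions if `k = 0`, and those inversions `(u, v)` with `0 ≤ v < k`
otherwise. (On `extAffine k` the set counted is finite.) -/
noncomputable def invCount (k : ℕ) (α : Equiv.Perm ℤ) : ℕ :=
  {p ∈ inversions α | k = 0 ∨ (0 ≤ p.2 ∧ p.2 < (k : ℤ))}.ncard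

namespace Graph

variable (Γ : Graph.{u})

/-- `k`-general transmission of the twice-marked graph `(Γ, v, w)`, for `k = 0` or `k ≥ 2`. -/
def HasGeneralTransmission (k : ℕ) (v w : Γ.Point) : Prop :=
  ∀ D : Γ.Divisor, Γ.IsSubmodular v w D ∧
    ∃ τ : Equiv.Perm ℤ, Γ.IsTransmissionPerm v w D τ ∧ τ ∈ extAffine k ∧
      (invCount k τ : ℤ) ≤ Γ.genus

end Graph

/-! ### Splitting types -/

/-- `x_m(μ) = ∑ max {0, μ_i + m + 1}`. -/
def splittingX {k : ℕ} (μ : Fin k → ℤ) (m : ℤ) : ℤ := ∑ i, max 0 (μ i + m + 1)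

/-- The expected codimension `|μ| = ∑_{i < j} max {0, μ_j - μ_i - 1}`. -/
def expectedCodim {k : ℕ} (μ : Fin k → ℤ) : ℤ :=
  ∑ p ∈ Finset.univ.filter fun p : Fin k × Fin k => p.1 < p.2, max 0 (μ p.2 - μ p.1 - 1)

namespace Graph

variable (Γ : Graph.{u})

/-- `d(μ) = g - 1 + ∑ (μ_i + 1)`. -/
def splittingDegree {k : ℕ} (μ : Fin k → ℤ) : ℤ := Γ.genus - 1 + ∑ i, (μ i + 1)

/-- The divisors whose class belongs to the splitting type locus of `μ` with respect to `F`. -/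
def splittingLocus (F : Γ.Divisor) {k : ℕ} (μ : Fin k → ℤ) : Set Γ.Divisor :=
  {D | Γ.deg D = Γ.splittingDegree μ ∧ ∀ m : ℤ, Γ.rank (D + m • F) = splittingX μ m - 1}

end Graph

end BrillNoether

/-! ### Degrees of canonical and principal divisors -/

namespace BrillNoether

/-! Everything is read off from the transmission permutation `τ` of `D` and its periodicity. Taking
`a = mk`, `b = 0`, the rank of `D + mF` plus one counts the `n ≥ 0` with `τ n ≤ mk`. Sorting these
`n` by residue `i` mod `k` gives `∑ max(0, ν_i + m + 1)` with `ν_i = ⌊-τ(i)/k⌋`, so `μ` is `ν`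
sorted (`ncard_nonneg_le`). A gap `ν_j - ν_i ≥ 2` forces `ν_j - ν_i - 1` inversions `(i - sk, j)`,
whence the codimension is at most the number of inversions mod `k`, hence at most `g`
(`sum_gaps_le_invCount`). For `D = 0`, periodicity also gives `kv ∼ kw` and `r(kv) ≥ 1`.

The degree of `D` needs Riemann–Roch, which is derived here from the hypothesis. The two counting
formulas show that `χ(D) = r(D) - r(K - D)` grows by exactly one when `v` is added. For any other
point `p`, growth by at most one follows in large degree, and equality follows because `kv - p` is
equivalent to an effective divisor (`eulerChar_add_chip`). Thus `χ` is degree plus a constant, and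
`χ(K) = -χ(0)` fixes the constant (`eulerChar_eq`). -/

theorem Multigraph.sum_valence (G : Multigraph.{u}) :
    ∑ x : G.V, ((G.valence x : ℤ) - 2) = 2 * G.genus - 2 := by
  have h1 : ∀ φ : G.E → G.V,
      ∑ x : G.V, (Finset.univ.filter fun e : G.E => φ e = x).card = Fintype.card G.E := fun φ => by
    rw [← Finset.card_eq_sum_card_fiberwise (fun e _ => Finset.mem_univ (φ e)), Finset.card_univ]
  have h2 : ∑ x : G.V, G.valence x = 2 * Fintype.card G.E := by
    simp only [Multigraph.valence, Finset.sum_add_distrib, h1]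
    ring
  rw [Finset.sum_sub_distrib, ← Nat.cast_sum, h2]
  simp only [Finset.sum_const, Finset.card_univ, Multigraph.genus]
  push_cast
  ring

/-- A sum over half-edges grouped by their endpoints is a sum over edges. -/
theorem Multigraph.sum_half_edges (G : Multigraph.{u}) (a b : G.E → ℤ) :
    ∑ x : G.V, ((∑ e ∈ Finset.univ.filter fun e : G.E => G.src e = x, a e) +
      ∑ e ∈ Finset.univ.filter fun e : G.E => G.tgt e = x, b e) = ∑ e, (a e + b e) := by
  rw [Finset.sum_add_distrib, Finset.sum_add_distrib,
    Finset.sum_fiberwise, Finset.sum_fiberwise]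

namespace FiniteGraph

variable (G : FiniteGraph.{u})

theorem isPrincipal_zero : G.IsPrincipal 0 := ⟨0, fun x => by simp⟩

variable {G}

theorem IsPrincipal.sub {D E : G.V →₀ ℤ} (hD : G.IsPrincipal D) (hE : G.IsPrincipal E) :
    G.IsPrincipal (D - E) := by
  obtain ⟨f, hf⟩ := hD
  obtain ⟨f', hf'⟩ := hE
  refine ⟨f - f', fun x => ?_⟩
  rw [Finsupp.sub_apply, hf x, hf' x, add_sub_add_comm, ← Finset.sum_sub_distrib,
    ← Finset.sum_sub_distrib]
  simp only [Pi.sub_apply]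
  congr 1 <;> exact Finset.sum_congr rfl fun e _ => by ring

theorem IsPrincipal.sum_eq_zero {D : G.V →₀ ℤ} (hD : G.IsPrincipal D) :
    (D.sum fun _ n => n) = 0 := by
  obtain ⟨f, hf⟩ := hD
  rw [Finsupp.sum_fintype _ _ fun _ => rfl]
  have : ∀ x : G.V, D x =
      (∑ e ∈ Finset.univ.filter fun e : G.E => G.src e = x, (f (G.tgt e) - f (G.src e))) +
      ∑ e ∈ Finset.univ.filter fun e : G.E => G.tgt e = x, (f (G.src e) - f (G.tgt e)) := by
    intro x
    rw [hf x]
    congr 1 <;> refine Finset.sum_congr rfl fun e he => ?_ <;>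
      rw [(Finset.mem_filter.mp he).2]
  simp_rw [this]
  rw [G.toMultigraph.sum_half_edges]
  exact Finset.sum_eq_zero fun e _ => by ring

end FiniteGraph

namespace MetricGraph

variable (Γ : MetricGraph.{u})

theorem isPrincipal_zero : Γ.IsPrincipal 0 :=
  ⟨0, 0, 0, by simp, by simp, by simp, by simp⟩

variable {Γ}

theorem IsPrincipal.sub {D E : Γ.Point →₀ ℤ} (hD : Γ.IsPrincipal D) (hE : Γ.IsPrincipal E) :
    Γ.IsPrincipal (D - E) := by
  obtain ⟨f, a, b, h1, h2, h3, h4⟩ := hD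
  obtain ⟨f', a', b', h1', h2', h3', h4'⟩ := hE
  refine ⟨f - f', a - a', b - b', fun e t ht => ?_, fun e t ht => ?_, fun x => ?_, fun e t => ?_⟩
  · filter_upwards [h1 e t ht, h1' e t ht] with u hu hu'
    simp only [Pi.sub_apply, hu, hu']
    push_cast
    ring
  · filter_upwards [h2 e t ht, h2' e t ht] with u hu hu'
    simp only [Pi.sub_apply, hu, hu']
    push_cast
    ring
  · rw [Finsupp.sub_apply, h3 x, h3' x, add_sub_add_comm, ← Finset.sum_sub_distrib,
      ← Finset.sum_sub_distrib]
    rfl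
  · rw [Finsupp.sub_apply, h4, h4']
    simp only [Pi.sub_apply]
    ring

/-- Transfers an affine formula valid just beyond a point to both sides of each nearby point `s`, so
that the slopes there can be compared by `slope_unique`. -/
theorem eventually_eventually_add {P : ℝ → Prop} (h : ∀ᶠ u in 𝓝[>] (0 : ℝ), P u) :
    ∀ᶠ s in 𝓝[>] (0 : ℝ), P s ∧ ∀ᶠ u in 𝓝[>] (0 : ℝ), P (s + u) ∧ P (s - u) := by
  obtain ⟨ε, hε, hP⟩ := mem_nhdsGT_iff_exists_Ioo_subset.mp h
  filter_upwards [Ioo_mem_nhdsGT hε] with s hs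
  refine ⟨hP hs, ?_⟩
  filter_upwards [Ioo_mem_nhdsGT (show (0 : ℝ) < min s (ε - s) from lt_min hs.1 (sub_pos.2 hs.2))]
    with u hu
  have h1 := lt_min_iff.mp hu.2
  have h2 := hu.1
  exact ⟨hP ⟨by linarith [hs.1], by linarith⟩, hP ⟨by linarith, by linarith [hs.2]⟩⟩

theorem slope_unique {φ : ℝ → ℝ} {c : ℝ} {a b : ℤ}
    (ha : ∀ᶠ u in 𝓝[>] (0 : ℝ), φ u = c + a * u)
    (hb : ∀ᶠ u in 𝓝[>] (0 : ℝ), φ u = c + b * u) : a = b := by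
  obtain ⟨u, ⟨h1, h2⟩, hu⟩ := ((ha.and hb).and self_mem_nhdsWithin).exists
  have hu' : (u : ℝ) ≠ 0 := ne_of_gt hu
  have : (a : ℝ) * u = b * u := by linarith
  exact_mod_cast mul_right_cancel₀ hu' this

/-- The slopes of a piecewise linear function on `[0, l]` with finitely many break points add up
to zero. -/
theorem slopes_sum_eq_zero {ι : Type*} (S : Finset ι) (x : ι → ℝ) (d : ι → ℤ) {l : ℝ} (hl : 0 < l)
    (φ : ℝ → ℝ) (fwd bwd : ℝ → ℤ)
    (hf : ∀ t ∈ Set.Ico 0 l, ∀ᶠ u in 𝓝[>] (0 : ℝ), φ (t + u) = φ t + (fwd t : ℝ) * u)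
    (hb : ∀ t ∈ Set.Ioc 0 l, ∀ᶠ u in 𝓝[>] (0 : ℝ), φ (t - u) = φ t + (bwd t : ℝ) * u)
    (hx : ∀ i ∈ S, x i ∈ Set.Ioo 0 l)
    (hd : ∀ t ∈ Set.Ioo 0 l, ∑ i ∈ S with x i = t, d i = fwd t + bwd t) :
    fwd 0 + bwd l + ∑ i ∈ S, d i = 0 := by
  classical
  -- The rightward slope at `s`, minus the bends met up to `s`. At each break the slope jumps by
  -- exactly the bend, so `ψ` is locally constant, hence continuous into `ℤ` and constant on `[0,
  -- l]`. At `l`, where no forward slope exists, the incoming slope `-bwd l` replaces it; comparing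
  -- the two ends gives the claim.
  set ψ : ℝ → ℤ := fun s => (if s < l then fwd s else -bwd l) - ∑ i ∈ S with x i ≤ s, d i with hψ
  have right : ∀ s ∈ Set.Ico 0 l, ∀ᶠ u in 𝓝[>] (0 : ℝ), ψ (s + u) = ψ s := by
    intro s hs
    have e1 : ∀ᶠ u in 𝓝[>] (0 : ℝ), ∀ i ∈ S, (x i ≤ s + u ↔ x i ≤ s) := by
      rw [Filter.eventually_all_finset]
      intro i _
      by_cases h : x i ≤ s
      · filter_upwards [self_mem_nhdsWithin] with u (hu : 0 < u)
        exact ⟨fun _ => h, fun _ => by linarith⟩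
      · filter_upwards [Ioo_mem_nhdsGT (show 0 < x i - s by linarith [not_le.mp h])] with u hu
        exact ⟨fun _ => by linarith [hu.2], fun h' => absurd h' h⟩
    filter_upwards [e1, eventually_eventually_add (hf s hs), self_mem_nhdsWithin,
      Ioo_mem_nhdsGT (sub_pos.2 hs.2)] with u h1 h2 (h3 : 0 < u) h4
    have hu : s + u < l := by linarith [h4.2]
    have h5 : fwd (s + u) = fwd s := by
      refine slope_unique (hf (s + u) ⟨by linarith [hs.1], hu⟩) ?_
      filter_upwards [h2.2] with r hr
      rw [add_assoc, hr.1, h2.1]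
      ring
    simp only [hψ, if_pos hu, if_pos hs.2, h5]
    rw [Finset.filter_congr h1]
  have left : ∀ s ∈ Set.Ioc 0 l, ∀ᶠ u in 𝓝[>] (0 : ℝ), ψ (s - u) = ψ s := by
    intro s hs
    have e1 : ∀ᶠ u in 𝓝[>] (0 : ℝ), ∀ i ∈ S, (x i ≤ s - u ↔ x i < s) := by
      rw [Filter.eventually_all_finset]
      intro i _
      by_cases h : x i < s
      · filter_upwards [Ioo_mem_nhdsGT (sub_pos.2 h)] with u hu
        exact ⟨fun _ => h, fun _ => by linarith [hu.2]⟩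
      · filter_upwards [self_mem_nhdsWithin] with u (hu : 0 < u)
        exact ⟨fun h' => by linarith, fun h' => absurd h' h⟩
    filter_upwards [e1, eventually_eventually_add (hb s hs), self_mem_nhdsWithin,
      Ioo_mem_nhdsGT hs.1] with u h1 h2 (h3 : 0 < u) h4
    have hu : s - u < l := by linarith [hs.2]
    have h5 : fwd (s - u) = -bwd s := by
      refine slope_unique (hf (s - u) ⟨by linarith [h4.2], hu⟩) ?_
      filter_upwards [h2.2] with r hr
      rw [sub_add, hr.2, h2.1]
      push_cast
      ring
    have h6 : ∑ i ∈ S with x i ≤ s, d i =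
        ∑ i ∈ S with x i < s, d i + ∑ i ∈ S with x i = s, d i := by
      rw [← Finset.sum_union]
      · refine Finset.sum_congr ?_ fun _ _ => rfl
        rw [← Finset.filter_or]
        exact Finset.filter_congr fun i _ => le_iff_lt_or_eq
      · exact Finset.disjoint_filter.mpr fun i _ h => ne_of_lt h
    simp only [hψ, if_pos hu, h5]
    rw [Finset.filter_congr h1, h6]
    rcases hs.2.lt_or_eq with h | h
    · rw [if_pos h, hd s ⟨hs.1, h⟩]
      ring
    · rw [if_neg (by rw [h]; exact lt_irrefl l), h, Finset.filter_false_of_mem (p := fun i => x i = l)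
        fun i hi => ne_of_lt (hx i hi).2]
      simp
  have cont : ContinuousOn ψ (Set.Icc 0 l) := by
    intro s hs
    have key : ∀ᶠ y in 𝓝[Set.Icc 0 l] s, ψ y = ψ s := by
      have hR : ∀ᶠ y in 𝓝[>] s, y ≤ l → ψ y = ψ s := by
        rcases hs.2.lt_or_eq with h | h
        · obtain ⟨ε, hε, hP⟩ := mem_nhdsGT_iff_exists_Ioo_subset.mp (right s ⟨hs.1, h⟩)
          filter_upwards [Ioo_mem_nhdsGT (show s < s + ε from lt_add_of_pos_right s hε)] with y hy _
          have := hP (show y - s ∈ Set.Ioo 0 ε from ⟨by linarith [hy.1], by linarith [hy.2]⟩)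
          simpa using this
        · filter_upwards [self_mem_nhdsWithin] with y (hy : s < y) hyl
          linarith
      have hL : ∀ᶠ y in 𝓝[<] s, 0 ≤ y → ψ y = ψ s := by
        rcases hs.1.lt_or_eq with h | h
        · obtain ⟨ε, hε, hP⟩ := mem_nhdsGT_iff_exists_Ioo_subset.mp (left s ⟨h, hs.2⟩)
          filter_upwards [Ioo_mem_nhdsLT (show s - ε < s from sub_lt_self s hε)] with y hy _
          have := hP (show s - y ∈ Set.Ioo 0 ε from ⟨by linarith [hy.2], by linarith [hy.1]⟩)
          simpa using this
        · filter_upwards [self_mem_nhdsWithin] with y (hy : y < s) hyl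
          linarith
      rw [eventually_nhdsWithin_iff]
      rw [eventually_nhdsWithin_iff] at hR hL
      filter_upwards [hR, hL] with y h1 h2 hy
      rcases lt_trichotomy y s with h | h | h
      · exact h2 h hy.1
      · rw [h]
      · exact h1 h hy.2
    exact tendsto_const_nhds.congr' (key.mono fun y hy => hy.symm)
  have h := isPreconnected_Icc.constant cont (Set.left_mem_Icc.2 hl.le) (Set.right_mem_Icc.2 hl.le)
  simp only [hψ, if_pos hl, lt_irrefl, if_false] at h
  rw [Finset.filter_false_of_mem fun i hi => not_le.2 (hx i hi).1,
    Finset.filter_true_of_mem fun i hi => (hx i hi).2.le] at h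
  simp only [Finset.sum_empty] at h
  linarith

theorem IsPrincipal.sum_eq_zero {D : Γ.Point →₀ ℤ} (hD : Γ.IsPrincipal D) :
    (D.sum fun _ n => n) = 0 := by
  obtain ⟨f, fwd, bwd, h1, h2, h3, h4⟩ := hD
  classical
  have hsplit : (D.sum fun _ n => n) = ∑ x : Γ.V, D (Sum.inl x) +
      ∑ e : Γ.E, ∑ y ∈ D.support.toRight with y.1 = e, D (Sum.inr y) := by
    rw [Finset.sum_fiberwise D.support.toRight (fun y => y.1) fun y => D (Sum.inr y), Finsupp.sum]
    conv_lhs => rw [← Finset.toLeft_disjSum_toRight (u := D.support)]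
    rw [Finset.sum_disjSum]
    congr 1
    refine Finset.sum_subset (Finset.subset_univ _) fun x _ hx => ?_
    simpa using hx
  rw [hsplit]
  simp_rw [h3]
  rw [Γ.toMultigraph.sum_half_edges (fun e => fwd e 0) (fun e => bwd e (Γ.length e)),
    ← Finset.sum_add_distrib]
  refine Finset.sum_eq_zero fun e _ => ?_
  refine slopes_sum_eq_zero (D.support.toRight.filter fun y => y.1 = e) (fun y => (y.2 : ℝ))
    (fun y => D (Sum.inr y)) (Γ.length_pos e) (fun t => f (Γ.pt e t)) (fwd e) (bwd e)
    (h1 e) (h2 e) ?_ ?_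
  · rintro ⟨e', y⟩ hy
    obtain rfl : e' = e := (Finset.mem_filter.mp hy).2
    exact y.2
  · intro t ht
    rw [← h4 e ⟨t, ht⟩, Finset.filter_filter]
    refine Finset.sum_eq_single (⟨e, ⟨t, ht⟩⟩ : (e : Γ.E) × Set.Ioo (0 : ℝ) (Γ.length e)) ?_ ?_
    · rintro ⟨e', y⟩ hy hne
      obtain ⟨-, rfl, rfl⟩ := Finset.mem_filter.mp hy
      exact absurd rfl hne
    · intro h
      by_contra h0
      exact h (Finset.mem_filter.mpr
        ⟨Finset.mem_toRight.mpr (Finsupp.mem_support_iff.mpr h0), rfl, rfl⟩)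

end MetricGraph

namespace Graph

variable (Γ : Graph.{u})

theorem isPrincipal_zero : Γ.IsPrincipal 0 := by
  cases Γ with
  | finite G => exact G.isPrincipal_zero
  | metric Γ => exact Γ.isPrincipal_zero

theorem deg_canonical : Γ.deg Γ.canonical = 2 * Γ.genus - 2 := by
  cases Γ with
  | finite G =>
    refine Eq.trans ?_ G.sum_valence
    change ((∑ x : G.V, Finsupp.single x ((G.valence x : ℤ) - 2)).sum fun _ n => n) = _
    rw [← Finsupp.sum_finsetSum_index (fun _ => rfl) (fun _ _ _ => rfl)]
    exact Finset.sum_congr rfl fun x _ => Finsupp.sum_single_index rfl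
  | metric Γ =>
    refine Eq.trans ?_ Γ.sum_valence
    change ((∑ x : Γ.V, Finsupp.single (Sum.inl x : Γ.Point) ((Γ.valence x : ℤ) - 2)).sum
      fun _ n => n) = _
    rw [← Finsupp.sum_finsetSum_index (fun _ => rfl) (fun _ _ _ => rfl)]
    exact Finset.sum_congr rfl fun x _ => Finsupp.sum_single_index rfl

variable {Γ}

theorem IsPrincipal.sub {D E : Γ.Divisor} (hD : Γ.IsPrincipal D) (hE : Γ.IsPrincipal E) :
    Γ.IsPrincipal (D - E) := by
  cases Γ with
  | finite G => exact FiniteGraph.IsPrincipal.sub hD hE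
  | metric Γ => exact MetricGraph.IsPrincipal.sub hD hE

theorem IsPrincipal.deg_eq_zero {D : Γ.Divisor} (hD : Γ.IsPrincipal D) : Γ.deg D = 0 := by
  cases Γ with
  | finite G => exact FiniteGraph.IsPrincipal.sum_eq_zero hD
  | metric Γ => exact MetricGraph.IsPrincipal.sum_eq_zero hD

end Graph
end BrillNoether

/-! ### Linear equivalence and the Baker–Norine rank -/

namespace BrillNoether
namespace Graph

variable {Γ : Graph.{u}}

theorem deg_add (D E : Γ.Divisor) : Γ.deg (D + E) = Γ.deg D + Γ.deg E :=
  Finsupp.sum_add_index' (fun _ => rfl) fun _ _ _ => rfl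

theorem deg_sub (D E : Γ.Divisor) : Γ.deg (D - E) = Γ.deg D - Γ.deg E :=
  Finsupp.sum_sub_index fun _ _ _ => rfl

theorem deg_zero : Γ.deg 0 = 0 := rfl

theorem deg_single (p : Γ.Point) (n : ℤ) : Γ.deg (Finsupp.single p n) = n :=
  Finsupp.sum_single_index rfl

theorem deg_chip (p : Γ.Point) : Γ.deg (Γ.chip p) = 1 := deg_single p 1

theorem zsmul_chip (p : Γ.Point) (n : ℤ) : n • Γ.chip p = Finsupp.single p n := by
  rw [chip, Finsupp.smul_single, smul_eq_mul, mul_one]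

theorem deg_zsmul_chip (p : Γ.Point) (n : ℤ) : Γ.deg (n • Γ.chip p) = n := by
  rw [zsmul_chip, deg_single]

theorem deg_nonneg {D : Γ.Divisor} (hD : 0 ≤ D) : 0 ≤ Γ.deg D :=
  Finset.sum_nonneg fun x _ => hD x

theorem eq_zero_of_deg_eq_zero {D : Γ.Divisor} (hD : 0 ≤ D) (h : Γ.deg D = 0) : D = 0 := by
  ext x
  by_contra hx
  exact hx ((Finset.sum_eq_zero_iff_of_nonneg fun x _ => hD x).mp h x (Finsupp.mem_support_iff.mpr hx))

theorem chip_nonneg (p : Γ.Point) : 0 ≤ Γ.chip p := Finsupp.single_nonneg.2 zero_le_one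

theorem point_nonempty (Γ : Graph.{u}) : Nonempty Γ.Point := by
  cases Γ with
  | finite G => exact G.nonempty
  | metric Γ => exact ⟨Sum.inl Γ.nonempty.some⟩

theorem exists_effective_deg {n : ℤ} (hn : 0 ≤ n) : ∃ E : Γ.Divisor, 0 ≤ E ∧ Γ.deg E = n :=
  ⟨Finsupp.single Γ.point_nonempty.some n, Finsupp.single_nonneg.2 hn, deg_single _ n⟩

theorem LinEquiv.refl (D : Γ.Divisor) : Γ.LinEquiv D D := by
  rw [LinEquiv, sub_self]; exact Γ.isPrincipal_zero

theorem LinEquiv.symm {D E : Γ.Divisor} (h : Γ.LinEquiv D E) : Γ.LinEquiv E D := by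
  have := Γ.isPrincipal_zero.sub h
  rwa [zero_sub, neg_sub] at this

theorem LinEquiv.trans {D E F : Γ.Divisor} (h : Γ.LinEquiv D E) (h' : Γ.LinEquiv E F) :
    Γ.LinEquiv D F := by
  have := IsPrincipal.sub h h'.symm
  rwa [sub_sub_sub_cancel_right] at this

theorem LinEquiv.sub_right {D E : Γ.Divisor} (h : Γ.LinEquiv D E) (F : Γ.Divisor) :
    Γ.LinEquiv (D - F) (E - F) := by
  rwa [LinEquiv, sub_sub_sub_cancel_right]

theorem LinEquiv.add_right {D E : Γ.Divisor} (h : Γ.LinEquiv D E) (F : Γ.Divisor) :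
    Γ.LinEquiv (D + F) (E + F) := by
  rwa [LinEquiv, add_sub_add_right_eq_sub]

theorem LinEquiv.sub_left {D E : Γ.Divisor} (h : Γ.LinEquiv D E) (F : Γ.Divisor) :
    Γ.LinEquiv (F - D) (F - E) := by
  rw [LinEquiv, sub_sub_sub_cancel_left]
  exact h.symm

theorem LinEquiv.deg_eq {D E : Γ.Divisor} (h : Γ.LinEquiv D E) : Γ.deg D = Γ.deg E := by
  have := IsPrincipal.deg_eq_zero h
  rw [deg_sub] at this
  linarith

theorem EquivEffective.deg_nonneg {D : Γ.Divisor} (h : Γ.EquivEffective D) : 0 ≤ Γ.deg D := by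
  obtain ⟨E, hE, hDE⟩ := h
  rw [hDE.deg_eq]
  exact Graph.deg_nonneg hE

theorem LinEquiv.equivEffective {D D' : Γ.Divisor} (h : Γ.LinEquiv D D')
    (hD : Γ.EquivEffective D) : Γ.EquivEffective D' := by
  obtain ⟨E, hE, hDE⟩ := hD
  exact ⟨E, hE, h.symm.trans hDE⟩

/-- `D` has Baker--Norine rank at least `n`. -/
def RankAtLeast (D : Γ.Divisor) (n : ℤ) : Prop :=
  -1 ≤ n ∧ ∀ E : Γ.Divisor, 0 ≤ E → Γ.deg E = n → Γ.EquivEffective (D - E)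

theorem rankAtLeast_neg_one (D : Γ.Divisor) : RankAtLeast D (-1) :=
  ⟨le_rfl, fun E hE h => by have := deg_nonneg hE; omega⟩

/-- This bound makes the supremum defining `rank` an attained maximum rather than a default value.
-/
theorem RankAtLeast.le_max {D : Γ.Divisor} {n : ℤ} (h : RankAtLeast D n) :
    n ≤ max (-1) (Γ.deg D) := by
  rcases lt_or_ge n 0 with hn | hn
  · exact le_max_of_le_left (by omega)
  · obtain ⟨E, hE, hd⟩ := exists_effective_deg (Γ := Γ) hn
    have := (h.2 E hE hd).deg_nonneg
    rw [deg_sub] at this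
    exact le_max_of_le_right (by omega)

theorem bddAbove_rankAtLeast (D : Γ.Divisor) : BddAbove {n | RankAtLeast D n} :=
  ⟨_, fun _ h => RankAtLeast.le_max h⟩

theorem rankAtLeast_rank (D : Γ.Divisor) : RankAtLeast D (Γ.rank D) :=
  Int.csSup_mem (s := {n | RankAtLeast D n}) ⟨-1, rankAtLeast_neg_one D⟩ (bddAbove_rankAtLeast D)

theorem RankAtLeast.le_rank {D : Γ.Divisor} {n : ℤ} (h : RankAtLeast D n) : n ≤ Γ.rank D :=
  le_csSup (bddAbove_rankAtLeast D) h

theorem neg_one_le_rank (D : Γ.Divisor) : -1 ≤ Γ.rank D := (rankAtLeast_rank D).1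

theorem rank_le_max (D : Γ.Divisor) : Γ.rank D ≤ max (-1) (Γ.deg D) := (rankAtLeast_rank D).le_max

theorem rank_of_deg_neg {D : Γ.Divisor} (h : Γ.deg D < 0) : Γ.rank D = -1 := by
  have h1 := rank_le_max D
  have h2 := neg_one_le_rank D
  omega

theorem rank_zero : Γ.rank 0 = 0 := by
  refine le_antisymm ((rank_le_max 0).trans (by simp [deg_zero])) ?_
  refine RankAtLeast.le_rank ⟨by norm_num, fun E hE h => ?_⟩
  rw [eq_zero_of_deg_eq_zero hE h, sub_zero]
  exact ⟨0, le_rfl, LinEquiv.refl 0⟩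

theorem LinEquiv.rank_le {D D' : Γ.Divisor} (h : Γ.LinEquiv D D') : Γ.rank D ≤ Γ.rank D' :=
  RankAtLeast.le_rank ⟨neg_one_le_rank D, fun E hE hd =>
    (h.sub_right E).equivEffective ((rankAtLeast_rank D).2 E hE hd)⟩

theorem LinEquiv.rank_eq {D D' : Γ.Divisor} (h : Γ.LinEquiv D D') : Γ.rank D = Γ.rank D' :=
  le_antisymm h.rank_le h.symm.rank_le

theorem rank_add_chip_le (D : Γ.Divisor) (p : Γ.Point) :
    Γ.rank (D + Γ.chip p) ≤ Γ.rank D + 1 := by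
  rcases (neg_one_le_rank (D + Γ.chip p)).eq_or_lt with h | h
  · have := neg_one_le_rank D
    omega
  · rw [← sub_le_iff_le_add]
    refine RankAtLeast.le_rank ⟨by omega, fun E hE hd => ?_⟩
    have := (rankAtLeast_rank (D + Γ.chip p)).2 (E + Γ.chip p) (add_nonneg hE (chip_nonneg p))
      (by rw [deg_add, deg_chip]; omega)
    rwa [add_sub_add_right_eq_sub] at this

theorem equivEffective_sub_chip {D : Γ.Divisor} (h : 1 ≤ Γ.rank D) (p : Γ.Point) :
    Γ.EquivEffective (D - Γ.chip p) := by
  -- The rank condition tests only divisors of degree exactly `r(D)`: subtract `r(D)` chips at `p`,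
  -- then give back `r(D) - 1` of them.
  obtain ⟨E, hE, hDE⟩ := (rankAtLeast_rank D).2 (Finsupp.single p (Γ.rank D))
    (Finsupp.single_nonneg.2 (by omega)) (deg_single p _)
  refine ⟨E + Finsupp.single p (Γ.rank D - 1),
    add_nonneg hE (Finsupp.single_nonneg.2 (by omega)), ?_⟩
  have := hDE.add_right (Finsupp.single p (Γ.rank D - 1))
  rw [Finsupp.single_sub, sub_add_sub_cancel] at this
  rwa [Finsupp.single_sub]

theorem linEquiv_of_rank_sub_eq_zero {D E : Γ.Divisor} (hr : Γ.rank (D - E) = 0)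
    (hd : Γ.deg (D - E) = 0) : Γ.LinEquiv D E := by
  obtain ⟨F, hF, h⟩ := (rankAtLeast_rank (D - E)).2 0 le_rfl (by rw [hr, deg_zero])
  rw [sub_zero] at h
  rwa [eq_zero_of_deg_eq_zero hF (h.deg_eq.symm.trans hd), LinEquiv, sub_zero] at h

end Graph
end BrillNoether

/-! ### Counting for permutations of the integers -/

namespace BrillNoether

section Permutations

/-- Only `c = τ⁻¹(a + 1)` changes status: it enters the first set if `c ≥ 0` and leaves the second
if `c < 0`. Either way the difference grows by one. -/
theorem ncard_sub_ncard_succ (τ : Equiv.Perm ℤ) (a : ℤ)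
    (h1 : {n : ℤ | 0 ≤ n ∧ τ n ≤ a}.Finite) (h2 : {n : ℤ | n < 0 ∧ a + 1 < τ n}.Finite) :
    ({n : ℤ | 0 ≤ n ∧ τ n ≤ a + 1}.ncard : ℤ) - ({n : ℤ | n < 0 ∧ a + 1 < τ n}.ncard : ℤ) =
      ({n : ℤ | 0 ≤ n ∧ τ n ≤ a}.ncard : ℤ) - ({n : ℤ | n < 0 ∧ a < τ n}.ncard : ℤ) + 1 := by
  obtain ⟨c, hc⟩ := τ.surjective (a + 1)
  have hτ : ∀ n, τ n = a + 1 ↔ n = c := fun n => by rw [← hc, τ.injective.eq_iff]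
  rcases lt_or_ge c 0 with h | h
  · have e1 : {n : ℤ | 0 ≤ n ∧ τ n ≤ a + 1} = {n : ℤ | 0 ≤ n ∧ τ n ≤ a} := by
      ext n
      have := hτ n
      simp only [Set.mem_ofPred_eq]
      grind
    have e2 : {n : ℤ | n < 0 ∧ a < τ n} = insert c {n : ℤ | n < 0 ∧ a + 1 < τ n} := by
      ext n
      have := hτ n
      simp only [Set.mem_ofPred_eq, Set.mem_insert_iff]
      grind
    rw [e1, e2, Set.ncard_insert_of_notMem (by simp [hc]) h2]
    push_cast
    ring
  · have e1 : {n : ℤ | 0 ≤ n ∧ τ n ≤ a + 1} = insert c {n : ℤ | 0 ≤ n ∧ τ n ≤ a} := by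
      ext n
      have := hτ n
      simp only [Set.mem_ofPred_eq, Set.mem_insert_iff]
      grind
    have e2 : {n : ℤ | n < 0 ∧ a < τ n} = {n : ℤ | n < 0 ∧ a + 1 < τ n} := by
      ext n
      have := hτ n
      simp only [Set.mem_ofPred_eq]
      grind
    rw [e1, e2, Set.ncard_insert_of_notMem (by simp [hc]) h1]
    push_cast
    ring

variable {k : ℕ} {τ : Equiv.Perm ℤ}

theorem apply_add_mul (hτ : ∀ n : ℤ, τ (n + k) = τ n + k) (n j : ℤ) :
    τ (n + j * k) = τ n + j * k := by
  induction j with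
  | zero => simp
  | succ j ih => rw [add_mul, one_mul, ← add_assoc, hτ, ih, add_assoc]
  | pred j ih =>
    have := hτ (n + (-(j : ℤ) - 1) * k)
    rw [show n + (-(j : ℤ) - 1) * k + k = n + -(j : ℤ) * k by ring, ih] at this
    linarith

/-- The displacement `τ n - n` is `k`-periodic, hence bounded by some `C`, and the two entries of an
inversion differ by less than `2C`. Finiteness is needed because `ncard` of an infinite set is `0`.
-/
theorem finite_inversions_mod (hk : 0 < k) (hτ : ∀ n : ℤ, τ (n + k) = τ n + k) :
    {p ∈ inversions τ | k = 0 ∨ (0 ≤ p.2 ∧ p.2 < (k : ℤ))}.Finite := by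
  have hk' : (0 : ℤ) < k := by exact_mod_cast hk
  obtain ⟨C, hC⟩ : ∃ C : ℤ, ∀ n, |τ n - n| ≤ C := by
    refine ⟨∑ i ∈ Finset.Ico (0 : ℤ) k, |τ i - i|, fun n => ?_⟩
    have h1 : τ n - n = τ (n % k) - n % k := by
      have := apply_add_mul hτ (n % k) (n / k)
      rw [mul_comm (n / (k : ℤ)), Int.emod_add_mul_ediv] at this
      rw [this]
      have := Int.emod_add_mul_ediv n k
      linarith
    rw [h1]
    exact Finset.single_le_sum (f := fun i : ℤ => |τ i - i|) (fun i _ => abs_nonneg _)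
      (Finset.mem_Ico.mpr ⟨Int.emod_nonneg _ hk'.ne', Int.emod_lt_of_pos _ hk'⟩)
  refine ((Set.finite_Icc (-2 * C) (k : ℤ)).prod (Set.finite_Icc (0 : ℤ) k)).subset ?_
  rintro ⟨u, v⟩ ⟨⟨h1, h2⟩, h3⟩
  simp only at h1 h2 h3
  have hu := abs_le.mp (hC u)
  have hv := abs_le.mp (hC v)
  refine ⟨⟨?_, ?_⟩, ⟨?_, ?_⟩⟩ <;> simp only <;> omega

/-- Division with remainder determines quotient and remainder. -/
theorem fin_add_mul_inj {i j : Fin k} {a b : ℤ}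
    (h : (i : ℤ) + a * k = (j : ℤ) + b * k) : i = j ∧ a = b := by
  have hk : (0 : ℤ) < k := by exact_mod_cast i.pos
  have hmod : ∀ (i : Fin k) (a : ℤ), ((i : ℤ) + a * k) % k = i := fun i a => by
    rw [Int.add_mul_emod_self_right, Int.emod_eq_of_lt (by positivity) (by exact_mod_cast i.isLt)]
  have hij : (i : ℤ) = j := by rw [← hmod i a, h, hmod]
  refine ⟨Fin.ext (by exact_mod_cast hij), ?_⟩
  rw [hij, add_right_inj] at h
  exact mul_right_cancel₀ hk.ne' h

/-- Write `n = i + jk` with `0 ≤ i < k` and `j ≥ 0`. By periodicity `τ n ≤ mk` means `j ≤ ⌊-τ(i)/k⌋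
+ m`, so each residue contributes one summand. -/
theorem ncard_nonneg_le (hk : 0 < k) (hτ : ∀ n : ℤ, τ (n + k) = τ n + k) (m : ℤ) :
    ({n : ℤ | 0 ≤ n ∧ τ n ≤ m * k}.ncard : ℤ) =
      splittingX (fun i : Fin k => -τ (i : ℤ) / (k : ℤ)) m := by
  have hk' : (0 : ℤ) < k := by exact_mod_cast hk
  set T : Finset (Σ _ : Fin k, ℤ) :=
    Finset.univ.sigma fun i : Fin k => Finset.Icc (0 : ℤ) (-τ (i : ℤ) / (k : ℤ) + m) with hT
  have hmem : ∀ (i : Fin k) (j : ℤ),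
      j ≤ -τ (i : ℤ) / (k : ℤ) + m ↔ τ ((i : ℤ) + j * k) ≤ m * k := by
    intro i j
    rw [apply_add_mul hτ, ← Int.add_mul_ediv_right _ _ hk'.ne', Int.le_ediv_iff_mul_le hk']
    constructor <;> intro h <;> linarith
  have hS : {n : ℤ | 0 ≤ n ∧ τ n ≤ m * k} =
      ↑(T.image fun x => (x.1 : ℤ) + x.2 * k) := by
    ext n
    simp only [Set.mem_ofPred_eq, Finset.coe_image, Set.mem_image, Finset.mem_coe, hT,
      Finset.mem_sigma, Finset.mem_univ, true_and, Finset.mem_Icc, Sigma.exists]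
    constructor
    · rintro ⟨h0, h1⟩
      have hr := Int.emod_nonneg n hk'.ne'
      have hr' := Int.emod_lt_of_pos n hk'
      have hn : ((n % k).toNat : ℤ) + n / k * k = n := by
        rw [Int.toNat_of_nonneg hr, mul_comm, Int.emod_add_mul_ediv]
      refine ⟨⟨(n % k).toNat, by omega⟩, n / k, ⟨Int.ediv_nonneg h0 hk'.le, ?_⟩, hn⟩
      rw [hmem]
      simpa only [hn] using h1
    · rintro ⟨i, j, ⟨h0, h1⟩, rfl⟩
      exact ⟨by positivity, (hmem i j).mp h1⟩
  rw [hS, Set.ncard_coe_finset, Finset.card_image_of_injOn, hT, Finset.card_sigma, splittingX]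
  · push_cast
    refine Finset.sum_congr rfl fun i _ => ?_
    rw [Int.card_Icc, Int.toNat_eq_max, max_comm, sub_zero]
  · rintro ⟨i, a⟩ _ ⟨j, b⟩ _ h
    obtain ⟨rfl, rfl⟩ := fin_add_mul_inj h
    rfl

/-- With `ν_i = ⌊-τ(i)/k⌋` and `1 ≤ s ≤ ν_j - ν_i - 1`, the pair `(i - sk, j)` is an inversion: `i -
sk < 0 ≤ j`, and `τ(i) - sk > -k(ν_i + 1 + s) ≥ -kν_j ≥ τ(j)`. Distinct triples `(i, j, s)` give
distinct pairs. Summing over all ordered pairs keeps the bound independent of the order of the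
`ν_i`. -/
theorem sum_gaps_le_invCount (hk : 0 < k) (hτ : ∀ n : ℤ, τ (n + k) = τ n + k) :
    ∑ p : Fin k × Fin k,
      max 0 (-τ (p.2 : ℤ) / (k : ℤ) - -τ (p.1 : ℤ) / (k : ℤ) - 1) ≤ invCount k τ := by
  have hk' : (0 : ℤ) < k := by exact_mod_cast hk
  set T : Finset (Σ _ : Fin k × Fin k, ℤ) := Finset.univ.sigma fun p : Fin k × Fin k =>
    Finset.Icc (1 : ℤ) (-τ (p.2 : ℤ) / (k : ℤ) - -τ (p.1 : ℤ) / (k : ℤ) - 1) with hT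
  have hcard : (T.card : ℤ) = ∑ p : Fin k × Fin k,
      max 0 (-τ (p.2 : ℤ) / (k : ℤ) - -τ (p.1 : ℤ) / (k : ℤ) - 1) := by
    rw [hT, Finset.card_sigma]
    push_cast
    refine Finset.sum_congr rfl fun i _ => ?_
    rw [Int.card_Icc, Int.toNat_eq_max, max_comm, add_sub_cancel_right]
  rw [← hcard, ← Set.ncard_coe_finset, invCount, Nat.cast_le]
  refine Set.ncard_le_ncard_of_injOn
    (fun x => (((x.1.1 : ℕ) : ℤ) + -x.2 * k, ((x.1.2 : ℕ) : ℤ))) ?_ ?_ (finite_inversions_mod hk hτ)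
  · rintro ⟨⟨i, j⟩, s⟩ hs
    simp only [hT, Finset.mem_coe, Finset.mem_sigma, Finset.mem_univ, true_and, Finset.mem_Icc] at hs
    obtain ⟨h1, h2⟩ := hs
    have hi : (i : ℤ) < k := by exact_mod_cast i.isLt
    have hj : (j : ℤ) < k := by exact_mod_cast j.isLt
    have hj0 : (0 : ℤ) ≤ (j : ℤ) := by positivity
    refine ⟨⟨?_, ?_⟩, Or.inr ⟨hj0, hj⟩⟩
    · simp only
      nlinarith
    · simp only
      rw [apply_add_mul hτ]
      have h3 := Int.ediv_mul_le (-τ (j : ℤ)) hk'.ne'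
      have h4 := Int.lt_ediv_add_one_mul_self (-τ (i : ℤ)) hk'
      nlinarith
  · rintro ⟨⟨i, j⟩, s⟩ _ ⟨⟨i', j'⟩, s'⟩ _ h
    obtain ⟨h1, h2⟩ := Prod.ext_iff.mp h
    obtain ⟨rfl, h3⟩ := fin_add_mul_inj h1
    obtain rfl : j = j' := Fin.ext (Nat.cast_injective (R := ℤ) h2)
    obtain rfl := neg_inj.mp h3
    rfl

end Permutations

/-! ### Riemann–Roch from transmission permutations -/

namespace Graph

variable {Γ : Graph.{u}} {v w : Γ.Point}

/-- The Euler characteristic `r(D) - r(K - D)`. -/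
noncomputable def eulerChar (D : Γ.Divisor) : ℤ := Γ.rank D - Γ.rank (Γ.canonical - D)

theorem LinEquiv.eulerChar_eq {D D' : Γ.Divisor} (h : Γ.LinEquiv D D') :
    eulerChar D = eulerChar D' := by
  rw [eulerChar, eulerChar, h.rank_eq, (h.sub_left Γ.canonical).rank_eq]

theorem twist_zero_right (D : Γ.Divisor) (a : ℤ) : Γ.twist v w D a 0 = D + a • Γ.chip v := by
  rw [twist, zero_smul, sub_zero]

theorem IsTransmissionPerm.eulerChar_add_chip {D : Γ.Divisor} {τ : Equiv.Perm ℤ}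
    (h : Γ.IsTransmissionPerm v w D τ) :
    eulerChar (D + Γ.chip v) = eulerChar D + 1 := by
  obtain ⟨⟨f0, r0⟩, f0', r0'⟩ := h 0 0
  obtain ⟨⟨f1, r1⟩, f1', r1'⟩ := h (0 + 1) 0
  have := ncard_sub_ncard_succ τ 0 f0 f1'
  rw [twist_zero_right, zero_smul, add_zero] at r0 r0'
  rw [twist_zero_right, zero_add, one_smul] at r1 r1'
  rw [zero_add] at this
  rw [eulerChar, eulerChar]
  linarith

theorem eulerChar_add_nsmul_chip (hv : ∀ D : Γ.Divisor, eulerChar (D + Γ.chip v) = eulerChar D + 1)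
    (D : Γ.Divisor) (n : ℕ) : eulerChar (D + n • Γ.chip v) = eulerChar D + n := by
  induction n with
  | zero => simp
  | succ n ih =>
    rw [succ_nsmul, ← add_assoc, hv, ih]
    push_cast
    ring

theorem deg_nsmul_chip (p : Γ.Point) (n : ℕ) : Γ.deg (n • Γ.chip p) = n := by
  rw [← natCast_zsmul, deg_zsmul_chip]

theorem eulerChar_eq_rank_add_one {D : Γ.Divisor} (h : Γ.deg Γ.canonical < Γ.deg D) :
    eulerChar D = Γ.rank D + 1 := by
  rw [eulerChar, rank_of_deg_neg (D := Γ.canonical - D) (by rw [deg_sub]; omega), sub_neg_eq_add]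

/-- Adding `n` chips at `v` shifts both sides by `n`. For `n` large the degree exceeds `deg K`,
where the Euler characteristic is the rank plus one, and a chip raises the rank by at most one. -/
theorem eulerChar_add_chip_le
    (hv : ∀ D : Γ.Divisor, eulerChar (D + Γ.chip v) = eulerChar D + 1)
    (D : Γ.Divisor) (p : Γ.Point) : eulerChar (D + Γ.chip p) ≤ eulerChar D + 1 := by
  set n := (Γ.deg Γ.canonical - Γ.deg D + 1).toNat with hn
  have h1 := eulerChar_add_nsmul_chip hv D n
  have h2 := eulerChar_add_nsmul_chip hv (D + Γ.chip p) n
  rw [eulerChar_eq_rank_add_one (by rw [deg_add, deg_nsmul_chip]; omega)] at h1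
  rw [eulerChar_eq_rank_add_one (by rw [deg_add, deg_add, deg_nsmul_chip, deg_chip]; omega),
    add_right_comm] at h2
  have := rank_add_chip_le (D + n • Γ.chip v) p
  omega

theorem eulerChar_add_le (hv : ∀ D : Γ.Divisor, eulerChar (D + Γ.chip v) = eulerChar D + 1)
    (D : Γ.Divisor) {E : Γ.Divisor} (hE : 0 ≤ E) : eulerChar (D + E) ≤ eulerChar D + Γ.deg E := by
  obtain ⟨n, hn⟩ := Int.eq_ofNat_of_zero_le (deg_nonneg hE)
  induction n generalizing E with
  | zero =>
    obtain rfl := eq_zero_of_deg_eq_zero hE (by simpa using hn)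
    simp [deg_zero]
  | succ n ih =>
    obtain ⟨x, hx⟩ : ∃ x, E x ≠ 0 := by
      by_contra! h
      obtain rfl : E = 0 := Finsupp.ext h
      rw [deg_zero] at hn
      omega
    have hx1 : 1 ≤ E x := by
      have : 0 ≤ E x := hE x
      omega
    have hE' : 0 ≤ E - Γ.chip x := by
      classical
      refine sub_nonneg.2 fun y => ?_
      rw [chip, Finsupp.single_apply]
      split_ifs with h
      · exact h ▸ hx1
      · exact hE y
    have hd : Γ.deg (E - Γ.chip x) = n := by
      rw [deg_sub, deg_chip, hn]
      push_cast
      ring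
    have h1 := ih hE' hd
    have h2 := eulerChar_add_chip_le hv (D + (E - Γ.chip x)) x
    rw [add_assoc, sub_add_cancel] at h2
    push_cast at hn
    omega

/-- Since `r(kv) ≥ 1`, `kv ∼ p + E` with `E` effective of degree `k - 1`. Passing from `D` to `D +
kv` gains exactly `k`, while `p` and `E` gain at most `1` and `k - 1`; both bounds are therefore
equalities. -/
theorem eulerChar_add_chip (hv : ∀ D : Γ.Divisor, eulerChar (D + Γ.chip v) = eulerChar D + 1)
    {k : ℕ} (hk : 1 ≤ Γ.rank (k • Γ.chip v)) (D : Γ.Divisor) (p : Γ.Point) :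
    eulerChar (D + Γ.chip p) = eulerChar D + 1 := by
  refine le_antisymm (eulerChar_add_chip_le hv D p) ?_
  obtain ⟨E, hE, h⟩ := equivEffective_sub_chip hk p
  have h1 := eulerChar_add_le hv (D + Γ.chip p) hE
  have h2 := (h.add_right (D + Γ.chip p)).eulerChar_eq
  rw [show k • Γ.chip v - Γ.chip p + (D + Γ.chip p) = D + k • Γ.chip v by abel,
    eulerChar_add_nsmul_chip hv, add_comm E] at h2
  have h3 := h.deg_eq
  rw [deg_sub, deg_chip, deg_nsmul_chip] at h3
  omega

theorem eulerChar_eq_deg_add (h : ∀ (D : Γ.Divisor) p, eulerChar (D + Γ.chip p) = eulerChar D + 1)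
    (D : Γ.Divisor) : eulerChar D = Γ.deg D + eulerChar (0 : Γ.Divisor) := by
  have hs : ∀ (p : Γ.Point) (n : ℤ) (D : Γ.Divisor),
      eulerChar (n • Γ.chip p + D) = n + eulerChar D := by
    intro p n D
    induction n with
    | zero => simp
    | succ n ih =>
      rw [add_smul, one_smul, add_right_comm, h, ih]
      ring
    | pred n ih =>
      have := h ((-(n : ℤ) - 1) • Γ.chip p + D) p
      rw [sub_smul, one_smul, sub_add_eq_add_sub, sub_add_cancel, ih] at this
      rw [sub_smul, one_smul, sub_add_eq_add_sub]
      linarith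
  induction D using Finsupp.induction with
  | zero => simp [deg_zero]
  | single_add p n D _ _ ih =>
    rw [← zsmul_chip, hs, ih, deg_add, deg_zsmul_chip, add_assoc]

/-- The Riemann--Roch theorem. -/
theorem eulerChar_eq (hv : ∀ D : Γ.Divisor, eulerChar (D + Γ.chip v) = eulerChar D + 1)
    {k : ℕ} (hk : 1 ≤ Γ.rank (k • Γ.chip v)) (D : Γ.Divisor) :
    eulerChar D = Γ.deg D - Γ.genus + 1 := by
  have h := eulerChar_eq_deg_add (eulerChar_add_chip hv hk)
  have h1 := h D
  have h2 := h Γ.canonical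
  -- The antisymmetry under `D ↦ K - D`, together with `deg K = 2g - 2`, forces the constant to be
  -- `1 - g`.
  have h3 : eulerChar Γ.canonical = -eulerChar (0 : Γ.Divisor) := by
    rw [eulerChar, eulerChar, sub_self, sub_zero, neg_sub]
  have h4 := Γ.deg_canonical
  omega

/-! ### Consequences of periodicity, and the proof of the theorem -/

/-- Translation by `k` matches the sets counted by `r(kv - kw) + 1` and `r(0) + 1`. So `kv - kw` has
rank `0` and degree `0`, hence is principal. -/
theorem IsTransmissionPerm.linEquiv {τ : Equiv.Perm ℤ} (h : Γ.IsTransmissionPerm v w 0 τ)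
    {k : ℕ} (hτ : ∀ n : ℤ, τ (n + k) = τ n + k) :
    Γ.LinEquiv (k • Γ.chip v) (k • Γ.chip w) := by
  have h0 := (h 0 0).1.2
  have hk := (h k k).1.2
  have e : {n : ℤ | (k : ℤ) ≤ n ∧ τ n ≤ k} = (fun n => n + (k : ℤ)) '' {n : ℤ | 0 ≤ n ∧ τ n ≤ 0} := by
    ext n
    constructor
    · rintro ⟨h1, h2⟩
      have := hτ (n - k)
      rw [sub_add_cancel] at this
      exact ⟨n - k, ⟨by omega, by omega⟩, sub_add_cancel _ _⟩
    · rintro ⟨m, ⟨h1, h2⟩, rfl⟩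
      refine ⟨by simp only; omega, ?_⟩
      simp only [hτ]
      omega
  rw [e, Set.ncard_image_of_injective _ (add_left_injective _), ← h0, twist_zero_right, zero_smul,
    add_zero, rank_zero, twist, zero_add, natCast_zsmul, natCast_zsmul] at hk
  refine linEquiv_of_rank_sub_eq_zero (by omega) ?_
  rw [deg_sub, deg_nsmul_chip, deg_nsmul_chip, sub_self]

/-- As `r(0) = 0`, some `n ≥ 0` has `τ n ≤ 0`; then `n` and `n + k` are both counted by `r(kv) + 1`.
-/
theorem IsTransmissionPerm.one_le_rank {τ : Equiv.Perm ℤ} (h : Γ.IsTransmissionPerm v w 0 τ)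
    {k : ℕ} (hk : 0 < k) (hτ : ∀ n : ℤ, τ (n + k) = τ n + k) :
    1 ≤ Γ.rank (k • Γ.chip v) := by
  have h0 := (h 0 0).1.2
  obtain ⟨hf, h1⟩ := (h k 0).1
  rw [twist_zero_right, zero_smul, add_zero, rank_zero] at h0
  rw [twist_zero_right, zero_add, natCast_zsmul] at h1
  obtain ⟨n, hn, hn'⟩ : {n : ℤ | 0 ≤ n ∧ τ n ≤ 0}.Nonempty :=
    Set.nonempty_of_ncard_ne_zero (by omega)
  have hsub : {n, n + (k : ℤ)} ⊆ {n : ℤ | 0 ≤ n ∧ τ n ≤ k} := by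
    rintro m (rfl | rfl)
    · exact ⟨hn, by omega⟩
    · exact ⟨by omega, by rw [hτ]; omega⟩
  have := Set.ncard_le_ncard hsub hf
  rw [Set.ncard_pair (by omega)] at this
  omega

theorem IsTransmissionPerm.rank_add_zsmul {D : Γ.Divisor} {τ : Equiv.Perm ℤ}
    (h : Γ.IsTransmissionPerm v w D τ) {k : ℕ} (hk : 0 < k)
    (hτ : ∀ n : ℤ, τ (n + k) = τ n + k) (m : ℤ) :
    Γ.rank (D + m • (k • Γ.chip v)) =
      splittingX (fun i : Fin k => -τ (i : ℤ) / (k : ℤ)) m - 1 := by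
  have := (h (m * k) 0).1.2
  rw [ncard_nonneg_le hk hτ, twist_zero_right, mul_smul, natCast_zsmul] at this
  omega

/-- The ranks of all twists of `D` by multiples of a divisor of degree `k` determine the degree
of `D`, by Riemann--Roch. -/
theorem deg_eq_splittingDegree (hRR : ∀ D : Γ.Divisor, eulerChar D = Γ.deg D - Γ.genus + 1)
    {k : ℕ} (hk : 0 < k) {D : Γ.Divisor} {μ : Fin k → ℤ}
    (hr : ∀ m : ℤ, Γ.rank (D + m • (k • Γ.chip v)) = splittingX μ m - 1) :
    Γ.deg D = Γ.splittingDegree μ := by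
  -- Large enough that `D + mF` has degree above `deg K` and that no maximum in `splittingX μ m` is
  -- truncated at `0`.
  set m : ℤ := |Γ.deg Γ.canonical - Γ.deg D| + 1 + ∑ i, |μ i| with hm
  have hk' : (1 : ℤ) ≤ k := by exact_mod_cast hk
  have hsum : 0 ≤ ∑ i, |μ i| := Finset.sum_nonneg fun i _ => abs_nonneg _
  have hd : Γ.deg (D + m • (k • Γ.chip v)) = Γ.deg D + m * k := by
    rw [← natCast_zsmul, smul_smul, deg_add, deg_zsmul_chip]
  have habs := le_abs_self (Γ.deg Γ.canonical - Γ.deg D)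
  have habs' := abs_nonneg (Γ.deg Γ.canonical - Γ.deg D)
  have h1 := eulerChar_eq_rank_add_one (D := D + m • (k • Γ.chip v)) (by rw [hd]; nlinarith)
  rw [hRR, hd, hr, sub_add_cancel] at h1
  have h2 : splittingX μ m = ∑ i, (μ i + 1) + m * k := by
    have : ∀ i, max 0 (μ i + m + 1) = (μ i + 1) + m := fun i => by
      have hi := Finset.single_le_sum (f := fun i => |μ i|) (fun i _ => abs_nonneg _)
        (Finset.mem_univ i)
      have := neg_abs_le (μ i)
      rw [max_eq_right (by omega)]
      ring
    simp only [splittingX, this]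
    rw [Finset.sum_add_distrib (f := fun i => μ i + 1)]
    simp [mul_comm]
  rw [splittingDegree]
  omega

end Graph

theorem splittingX_comp_perm {k : ℕ} (μ : Fin k → ℤ) (σ : Equiv.Perm (Fin k)) (m : ℤ) :
    splittingX (μ ∘ σ) m = splittingX μ m :=
  Equiv.sum_comp σ fun i => max 0 (μ i + m + 1)

/-- The sum over all ordered pairs is invariant under reordering and its terms are nonnegative, so
it dominates the part with `i < j`. -/
theorem expectedCodim_comp_perm_le {k : ℕ} (μ : Fin k → ℤ) (σ : Equiv.Perm (Fin k)) :
    expectedCodim (μ ∘ σ) ≤ ∑ p : Fin k × Fin k, max 0 (μ p.2 - μ p.1 - 1) := by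
  rw [← Equiv.sum_comp (σ.prodCongr σ)]
  exact Finset.sum_le_sum_of_subset_of_nonneg (Finset.filter_subset _ _)
    fun _ _ _ => le_max_left _ _

end BrillNoether

theorem theoremC (Γ : BrillNoether.Graph.{u}) (v w : Γ.Point) (k : ℕ) (hk : 2 ≤ k)
    (hΓ : Γ.HasGeneralTransmission k v w) :
    Γ.LinEquiv (k • Γ.chip v) (k • Γ.chip w) ∧
    1 ≤ Γ.rank (k • Γ.chip v) ∧
    ∀ D : Γ.Divisor, ∃ μ : Fin k → ℤ, Monotone μ ∧
      D ∈ Γ.splittingLocus (k • Γ.chip v) μ ∧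
      BrillNoether.expectedCodim μ ≤ Γ.genus := by
  have hk0 : 0 < k := by omega
  have hper : ∀ D : Γ.Divisor, ∃ τ : Equiv.Perm ℤ, Γ.IsTransmissionPerm v w D τ ∧
      (∀ n : ℤ, τ (n + k) = τ n + k) ∧ (BrillNoether.invCount k τ : ℤ) ≤ Γ.genus := by
    intro D
    obtain ⟨-, τ, h1, h2, h3⟩ := hΓ D
    rw [BrillNoether.extAffine, Set.mem_ofPred_eq, if_neg hk0.ne'] at h2
    exact ⟨τ, h1, h2, h3⟩
  obtain ⟨τ₀, h₀, hτ₀, -⟩ := hper 0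
  have hrank := h₀.one_le_rank hk0 hτ₀
  refine ⟨h₀.linEquiv hτ₀, hrank, fun D => ?_⟩
  obtain ⟨τ, h, hτ, hinv⟩ := hper D
  set ν : Fin k → ℤ := fun i => -τ (i : ℤ) / (k : ℤ) with hν
  have hr : ∀ m : ℤ, Γ.rank (D + m • (k • Γ.chip v)) =
      BrillNoether.splittingX (ν ∘ Tuple.sort ν) m - 1 := fun m => by
    rw [BrillNoether.splittingX_comp_perm, h.rank_add_zsmul hk0 hτ]
  -- Riemann–Roch draws on the transmission permutations of all divisors, not only that of `D`.
  have hRR := BrillNoether.Graph.eulerChar_eq (v := v)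
    (fun D => (hper D).choose_spec.1.eulerChar_add_chip) hrank
  exact ⟨ν ∘ Tuple.sort ν, Tuple.monotone_sort ν,
    ⟨BrillNoether.Graph.deg_eq_splittingDegree hRR hk0 hr, hr⟩,
    (BrillNoether.expectedCodim_comp_perm_le ν _).trans
      ((BrillNoether.sum_gaps_le_invCount hk0 hτ).trans hinv)⟩
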